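/- Let $\zeta$ be the Riemann zeta function. For every complex number $s$ that is not an integer $\le 1$, $$\zeta(s)=\frac{\pi^{s/2}}{2(s-1)\,\Gamma(1+s/2)}\prod_{\operatorname{Im}\rho>0}\Bigl\{\Bigl(1-\frac{s}{\rho}\Bigr)\Bigl(1-\frac{s}{1-\rho}\Bigr)\Bigr\},$$ where $\rho$ runs through the zeros of $\zeta$ with positive imaginary part, each repeated according to its multiplicity. The factors are the bracketed products, and the infinite product converges unconditionally, that is, its finite partial products converge to the same value in every order of the factors. -/

import Mathlib

/-- The non-real zeros of the Riemann zeta function in the upper half-plane, as a set. -/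
def upperZetaZeros : Set ℂ := {ρ | riemannZeta ρ = 0 ∧ 0 < ρ.im}

/-- The index type of the zeros of `ζ` with positive imaginary part, counted with multiplicity:
a zero `ρ` of order `m` contributes the `m` indices `⟨ρ, 0⟩, …, ⟨ρ, m - 1⟩`. -/
abbrev UpperZetaZeroIndex : Type :=
  Σ ρ : upperZetaZeros, Fin (analyticOrderNatAt riemannZeta (ρ : ℂ))

/-- The factor `(1 - s/ρ) (1 - s/(1-ρ))`. -/
noncomputable def zetaZeroFactor (s ρ : ℂ) : ℂ := (1 - s / ρ) * (1 - s / (1 - ρ))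

/-! Put ξ(s) = 1 - s(1-s)Λ₀(s), which equals s(s-1)Λ(s) away from 0 and 1. It is entire and
invariant under s ↦ 1-s, so ξ(s) = h(s(1-s)) with h entire and h(0) = 1. As log |ξ(s)| =
O(|s|^(3/2)) for large |s| and s(1-s) is quadratic, log |h(z)| = O(|z|^(3/4)). Hadamard's theorem
for order below one (`Differentiable.hasProd_zeros`) writes h(z) as the absolutely convergent
product of 1 - z/a over its zeros a, with no exponential factor. The zeros of ξ are non-real, so ρ ↦
ρ(1-ρ) maps the zeros of ζ in the upper half-plane bijectively, with multiplicities, onto those of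
h; moreover 1 - s(1-s)/(ρ(1-ρ)) is the bracketed factor.

For Hadamard's theorem, divide out the zeros in |a| ≤ R to get a quotient g_R. The maximum principle
on |w| ≤ 4R bounds both their number and |g_R| by the growth of h. The count gives absolute
convergence; Borel–Carathéodory applied to log g_R gives log g_R(z) = O(R^(α-1)) → 0.

The growth of ξ needs no Stirling formula: Λ₀ is a Mellin transform of a nonnegative function, so
its modulus on a strip is controlled by its values at even integers, where ζ is bounded and the
Gamma factor is at most a factorial. -/

open Filter Topology Metric

/-! ### Hadamard factorization in order less than one -/

/-- An entire function divided by a power of `z - b` that its order at `b` allows is entire. -/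
theorem Differentiable.exists_eq_pow_mul {g : ℂ → ℂ} (hg : Differentiable ℂ g) (b : ℂ) (m : ℕ)
    (hm : (m : ℕ∞) ≤ analyticOrderAt g b) :
    ∃ q : ℂ → ℂ, Differentiable ℂ q ∧ ∀ z, g z = (z - b) ^ m * q z := by
  induction m with
  | zero => exact ⟨g, hg, by simp⟩
  | succ m ih =>
    obtain ⟨q, hq, hgq⟩ := ih (le_trans (by exact_mod_cast m.le_succ) hm)
    have hqb : q b = 0 := by
      by_contra hne
      have horder : analyticOrderAt g b = m :=
        (hg.analyticAt b).analyticOrderAt_eq_natCast.2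
          ⟨q, hq.analyticAt b, hne, Eventually.of_forall fun z => by simp [hgq z]⟩
      rw [horder] at hm
      exact absurd (by exact_mod_cast hm) (Nat.not_succ_le_self m)
    refine ⟨dslope q b, ?_, fun z => ?_⟩
    · rw [← differentiableOn_univ]
      exact (Complex.differentiableOn_dslope univ_mem).2 hq.differentiableOn
    · have := sub_smul_dslope q b z
      rw [hqb, sub_zero, smul_eq_mul] at this
      rw [hgq z, pow_succ, mul_assoc, this]

/-- Finitely many zeros of an entire function can be divided out, with multiplicities. -/
theorem Differentiable.exists_eq_mul_prod_zeros {h : ℂ → ℂ} (hh : Differentiable ℂ h)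
    (hfin : ∀ a, analyticOrderAt h a ≠ ⊤) (S : Finset ℂ) (hS : ∀ a ∈ S, a ≠ 0) :
    ∃ g : ℂ → ℂ, Differentiable ℂ g ∧ (∀ a ∈ S, g a ≠ 0) ∧
      ∀ z, h z = g z * ∏ a ∈ S, (1 - z / a) ^ analyticOrderNatAt h a := by
  classical
  induction S using Finset.induction_on with
  | empty => exact ⟨h, hh, by simp, by simp⟩
  | insert b S hb ih =>
    obtain ⟨g, hg, hgS, hgh⟩ := ih fun a ha => hS a (Finset.mem_insert_of_mem ha)
    have hb0 : b ≠ 0 := hS b (Finset.mem_insert_self b S)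
    have hprod : Differentiable ℂ fun z => ∏ a ∈ S, (1 - z / a) ^ analyticOrderNatAt h a := by
      fun_prop
    have hprodb : ∏ a ∈ S, (1 - b / a) ^ analyticOrderNatAt h a ≠ 0 := by
      refine Finset.prod_ne_zero_iff.2 fun a ha => pow_ne_zero _ ?_
      have ha0 : a ≠ 0 := hS a (Finset.mem_insert_of_mem ha)
      have hab : b ≠ a := fun e => hb (e ▸ ha)
      rw [sub_ne_zero, ne_comm, Ne, div_eq_one_iff_eq ha0]
      exact hab
    have hord : analyticOrderAt g b = analyticOrderAt h b := by
      have h1 : h = g * fun z => ∏ a ∈ S, (1 - z / a) ^ analyticOrderNatAt h a := funext hgh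
      conv_rhs => rw [h1]
      rw [analyticOrderAt_mul (hg.analyticAt b) (hprod.analyticAt b),
        ((hprod.analyticAt b).analyticOrderAt_eq_zero).2 hprodb, add_zero]
    have hcast : ((analyticOrderNatAt h b : ℕ) : ℕ∞) = analyticOrderAt h b :=
      Nat.cast_analyticOrderNatAt (hfin b)
    obtain ⟨q, hq, hgq⟩ := hg.exists_eq_pow_mul b (analyticOrderNatAt h b) (by rw [hord, hcast])
    have hqb : q b ≠ 0 := by
      intro hq0
      have h1 : g = (fun z => (z - b) ^ analyticOrderNatAt h b) * q := funext hgq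
      have h2 : analyticOrderAt g b = analyticOrderNatAt h b + analyticOrderAt q b := by
        have hA : AnalyticAt ℂ (fun z : ℂ => (z - b) ^ analyticOrderNatAt h b) b := by fun_prop
        conv_lhs => rw [h1]
        rw [analyticOrderAt_mul hA (hq.analyticAt b)]
        congr 1
        exact analyticOrderAt_centeredMonomial
      have h3 : analyticOrderAt q b ≠ 0 := (hq.analyticAt b).analyticOrderAt_ne_zero.2 hq0
      rw [hord, ← hcast] at h2
      generalize analyticOrderAt q b = n at h2 h3
      induction n using ENat.recTopCoe with
      | top => simp at h2
      | coe n =>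
        norm_cast at h2 h3
        omega
    refine ⟨fun z => (-b) ^ analyticOrderNatAt h b * q z, by fun_prop, ?_, fun z => ?_⟩
    · intro a ha
      refine mul_ne_zero (pow_ne_zero _ (neg_ne_zero.2 hb0)) ?_
      rcases Finset.mem_insert.1 ha with rfl | ha
      · exact hqb
      · intro h0
        exact hgS a ha (by rw [hgq, h0, mul_zero])
    · have hz : (z - b) ^ analyticOrderNatAt h b =
          (-b) ^ analyticOrderNatAt h b * (1 - z / b) ^ analyticOrderNatAt h b := by
        rw [← mul_pow]; congr 1; field_simp; ring
      rw [Finset.prod_insert hb, hgh z, hgq z, hz]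
      ring

/-- A zero-free entire function normalised at `0` whose modulus is at most `exp M` on a disc of
radius `R` is close to `1` near the centre of the disc. -/
theorem exists_log_norm_le_of_norm_le_exp {g : ℂ → ℂ} (hg : Differentiable ℂ g) {R M : ℝ}
    (hR : 0 < R) (hM : 0 < M) (hg0 : g 0 = 1) (hne : ∀ z ∈ ball (0 : ℂ) R, g z ≠ 0)
    (hle : ∀ z ∈ ball (0 : ℂ) R, ‖g z‖ ≤ Real.exp M) {z : ℂ} (hz : ‖z‖ < R) :
    ∃ w : ℂ, g z = Complex.exp w ∧ ‖w‖ ≤ 2 * M * ‖z‖ / (R - ‖z‖) := by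
  have hlog : DifferentiableOn ℂ (fun z => deriv g z / g z) (ball 0 R) := by
    intro x hx
    exact ((hg.deriv x).div (hg x) (hne x hx)).differentiableWithinAt
  obtain ⟨G₀, hG₀⟩ := hlog.isExactOn_ball
  set G : ℂ → ℂ := fun z => G₀ z - G₀ 0 with hGdef
  have hG : ∀ x ∈ ball (0 : ℂ) R, HasDerivAt G (deriv g x / g x) x := fun x hx =>
    (hG₀ x hx).sub_const _
  -- G is the primitive of g'/g vanishing at 0, so g · exp(-G) has derivative zero and is constantly
  -- 1.
  have hexp : ∀ x ∈ ball (0 : ℂ) R, g x = Complex.exp (G x) := by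
    have hder : ∀ x ∈ ball (0 : ℂ) R,
        HasDerivAt (fun y => g y * Complex.exp (-G y)) 0 x := by
      intro x hx
      have h1 : HasDerivAt (fun y => g y * Complex.exp (-G y)) (deriv g x * Complex.exp (-G x) +
          g x * (Complex.exp (-G x) * -(deriv g x / g x))) x :=
        (hg x).hasDerivAt.mul ((hG x hx).neg.cexp)
      have h2 : deriv g x * Complex.exp (-G x) +
          g x * (Complex.exp (-G x) * -(deriv g x / g x)) = 0 := by
        rw [mul_left_comm, mul_neg, mul_div_cancel₀ _ (hne x hx)]
        ring
      rwa [h2] at h1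
    intro x hx
    have hc := (convex_ball (0 : ℂ) R).is_const_of_fderivWithin_eq_zero (𝕜 := ℂ)
      (f := fun y => g y * Complex.exp (-G y))
      (fun y hy => (hder y hy).differentiableAt.differentiableWithinAt)
      (fun y hy => by
        rw [fderivWithin_of_isOpen isOpen_ball hy]
        ext
        simp [(hder y hy).deriv]) hx (mem_ball_self hR)
    simp only [hGdef, sub_self, neg_zero, Complex.exp_zero, mul_one, hg0] at hc
    rw [← hGdef] at *
    rw [Complex.exp_neg, mul_inv_eq_one₀ (Complex.exp_ne_zero _)] at hc
    exact hc
  have hz' : z ∈ ball (0 : ℂ) R := by simpa using hz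
  refine ⟨G z, hexp z hz', Complex.borelCaratheodory_zero hM
    (fun x hx => (hG x hx).differentiableAt.differentiableWithinAt) (fun x hx => ?_) hR hz'
    (by simp [hGdef])⟩
  have h1 := hle x hx
  rw [hexp x hx, Complex.norm_exp, Real.exp_le_exp] at h1
  exact h1

/-- If at most `C * R ^ α` of the positive numbers `x i` are at most `R`, with `α < 1`, then the
reciprocals of the `x i` are summable. -/
theorem summable_inv_of_card_le {ι : Type*} {x : ι → ℝ} {δ C α : ℝ} (hδ : 0 < δ) (hα : α < 1)
    (hx : ∀ i, δ ≤ x i)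
    (hcard : ∀ R : ℝ, 1 ≤ R → ∀ U : Finset ι, (∀ i ∈ U, x i ≤ R) → (U.card : ℝ) ≤ C * R ^ α) :
    Summable fun i => (x i)⁻¹ := by
  classical
  have hxpos : ∀ i, 0 < x i := fun i => hδ.trans_le (hx i)
  set k : ι → ℕ := fun i => Nat.clog 2 ⌈x i⌉₊
  have hle : ∀ i, x i ≤ 2 ^ k i := fun i =>
    (Nat.le_ceil _).trans (by exact_mod_cast Nat.le_pow_clog one_lt_two ⌈x i⌉₊)
  -- The summand 2 serves the dyadic blocks k > 0, where 2^(k-1) < x; the summand δ⁻¹ serves the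
  -- block k = 0, which contains every x ≤ 1.
  set D : ℝ := 2 + δ⁻¹
  have hD : 0 < D := by positivity
  have hinv : ∀ i, (x i)⁻¹ ≤ D * (2 ^ k i)⁻¹ := by
    intro i
    have h1 : (2 : ℝ) ^ k i ≤ D * x i := by
      rcases Nat.eq_zero_or_pos (k i) with h0 | h0
      · rw [h0, pow_zero]
        have : 1 ≤ δ⁻¹ * x i := by
          rw [← inv_mul_cancel₀ hδ.ne']
          exact mul_le_mul_of_nonneg_left (hx i) (by positivity)
        nlinarith [hxpos i]
      · have h2 : 2 ^ (k i - 1) < ⌈x i⌉₊ := by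
          rw [← not_le]
          intro h3
          have := (Nat.clog_le_iff_le_pow one_lt_two).2 h3
          change k i ≤ k i - 1 at this
          omega
        have h3 : ((2 ^ (k i - 1) : ℕ) : ℝ) < x i := Nat.lt_ceil.1 h2
        push_cast at h3
        have h4 : (2 : ℝ) ^ k i = 2 * 2 ^ (k i - 1) := by
          rw [← pow_succ', Nat.sub_add_cancel h0]
        have h5 : 0 ≤ δ⁻¹ * x i := by have := hxpos i; positivity
        nlinarith
    rw [inv_le_iff_one_le_mul₀ (hxpos i), mul_right_comm, ← div_eq_mul_inv,
      one_le_div (by positivity)]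
    exact h1
  have hC : 0 ≤ C := by simpa using hcard 1 le_rfl ∅ (by simp)
  set r : ℝ := 2 ^ (α - 1)
  have hr0 : 0 ≤ r := by positivity
  have hr1 : r < 1 := Real.rpow_lt_one_of_one_lt_of_neg one_lt_two (by linarith)
  have hgeom : Summable fun n : ℕ => C * D * r ^ n :=
    (summable_geometric_of_lt_one hr0 hr1).mul_left _
  refine summable_of_sum_le (c := ∑' n : ℕ, C * D * r ^ n)
    (fun i => (inv_pos.2 (hxpos i)).le) fun U => ?_
  calc ∑ i ∈ U, (x i)⁻¹
      = ∑ n ∈ U.image k, ∑ i ∈ U with k i = n, (x i)⁻¹ :=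
        (Finset.sum_fiberwise_of_maps_to (fun i hi => Finset.mem_image_of_mem k hi) _).symm
    _ ≤ ∑ n ∈ U.image k, C * D * r ^ n := by
        refine Finset.sum_le_sum fun n _ => ?_
        have h1 : ∑ i ∈ U with k i = n, (x i)⁻¹ ≤
            ∑ i ∈ U with k i = n, D * (2 ^ n : ℝ)⁻¹ := by
          refine Finset.sum_le_sum fun i hi => ?_
          rw [← (Finset.mem_filter.1 hi).2]
          exact hinv i
        refine h1.trans ?_
        rw [Finset.sum_const, nsmul_eq_mul]
        have h2 := hcard (2 ^ n) (one_le_pow₀ one_le_two) (U.filter fun i => k i = n) (by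
          intro i hi
          rw [← (Finset.mem_filter.1 hi).2]
          exact hle i)
        have h3 : ((2 : ℝ) ^ n) ^ α * (2 ^ n)⁻¹ = r ^ n := by
          have h4 : ((2 : ℝ) ^ n)⁻¹ = (2 ^ n) ^ (-1 : ℝ) := (Real.rpow_neg_one _).symm
          rw [h4, ← Real.rpow_add (by positivity), ← sub_eq_add_neg, ← Real.rpow_natCast 2 n,
            ← Real.rpow_mul (by norm_num), mul_comm (n : ℝ), Real.rpow_mul (by norm_num),
            Real.rpow_natCast]
        calc _ ≤ C * ((2 : ℝ) ^ n) ^ α * (D * (2 ^ n)⁻¹) := by gcongr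
          _ = C * D * (((2 : ℝ) ^ n) ^ α * (2 ^ n)⁻¹) := by ring
          _ = _ := by rw [h3]
    _ ≤ ∑' n : ℕ, C * D * r ^ n :=
        hgeom.sum_le_tsum _ fun n _ => by positivity

/-- The zeros of a function, each repeated according to its multiplicity. -/
abbrev ZeroIndex (h : ℂ → ℂ) : Type := Σ a : {a : ℂ // h a = 0}, Fin (analyticOrderNatAt h a)

theorem Differentiable.analyticOrderAt_ne_top {h : ℂ → ℂ} (hh : Differentiable ℂ h) {b : ℂ}
    (hb : h b ≠ 0) (a : ℂ) : analyticOrderAt h a ≠ ⊤ := by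
  have hA : AnalyticOnNhd ℂ h Set.univ := fun z _ => hh.analyticAt z
  refine hA.analyticOrderAt_ne_top_of_isPreconnected isPreconnected_univ (Set.mem_univ b)
    (Set.mem_univ a) ?_
  rw [(hh.analyticAt b).analyticOrderAt_eq_zero.2 hb]
  exact ENat.zero_ne_top

theorem Differentiable.finite_zeros_closedBall {h : ℂ → ℂ} (hh : Differentiable ℂ h) {b : ℂ}
    (hb : h b ≠ 0) (R : ℝ) : {a : ℂ | h a = 0 ∧ ‖a‖ ≤ R}.Finite := by
  have hA : AnalyticOnNhd ℂ h Set.univ := fun z _ => hh.analyticAt z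
  have hcod := hA.preimage_zero_mem_codiscrete hb
  obtain ⟨hcl, hdis⟩ := mem_codiscrete'.1 hcod
  have hfin : (closedBall (0 : ℂ) R ∩ h ⁻¹' {0}).Finite := by
    refine ((isCompact_closedBall 0 R).inter_right ?_).finite ?_
    · simpa using hcl
    · exact IsDiscrete.mono (by simpa using hdis) Set.inter_subset_right
  refine hfin.subset fun a ha => ⟨by simpa using ha.2, ha.1⟩

/-- Dividing out zeros in the disc of radius `R` decreases the maximum modulus on the disc of
radius `4 * R` by a factor exponential in the number of these zeros. -/
theorem norm_mul_exp_le_of_eq_mul_prod {h g : ℂ → ℂ} (hg : Differentiable ℂ g) {S : Finset ℂ}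
    {m : ℂ → ℕ} {R B : ℝ} (hR : 0 < R) (hS : ∀ a ∈ S, a ≠ 0 ∧ ‖a‖ ≤ R)
    (hgh : ∀ z, h z = g z * ∏ a ∈ S, (1 - z / a) ^ m a)
    (hB : ∀ z, ‖z‖ ≤ 4 * R → ‖h z‖ ≤ B) {z : ℂ} (hz : ‖z‖ ≤ 4 * R) :
    ‖g z‖ * Real.exp (∑ a ∈ S, m a : ℕ) ≤ B := by
  rw [← le_div_iff₀ (Real.exp_pos _)]
  refine Complex.norm_le_of_forall_mem_frontier_norm_le (U := ball (0 : ℂ) (4 * R))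
    isBounded_ball hg.diffContOnCl (fun w hw => ?_) ?_
  · rw [frontier_ball (0 : ℂ) (by positivity), mem_sphere_zero_iff_norm] at hw
    rw [le_div_iff₀ (Real.exp_pos _)]
    refine le_trans ?_ (hB w hw.le)
    rw [hgh w, norm_mul]
    refine mul_le_mul_of_nonneg_left ?_ (norm_nonneg _)
    rw [norm_prod, Nat.cast_sum, Real.exp_sum]
    refine Finset.prod_le_prod (fun _ _ => (Real.exp_pos _).le) fun a ha => ?_
    obtain ⟨ha0, haR⟩ := hS a ha
    have hap : 0 < ‖a‖ := norm_pos_iff.2 ha0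
    rw [norm_pow, ← mul_one (m a : ℝ), Real.exp_nat_mul]
    refine pow_le_pow_left₀ (Real.exp_pos _).le ?_ _
    -- The radius 4R makes each factor at least 4 - 1 = 3 > e on the boundary, hence one factor e
    -- per zero.
    have h1 : 4 ≤ ‖w / a‖ := by
      rw [norm_div, hw, le_div_iff₀ hap]
      linarith
    have h2 := norm_sub_norm_le (w / a) 1
    rw [norm_one, norm_sub_rev] at h2
    linarith [Real.exp_one_lt_three]
  · rw [closure_ball (0 : ℂ) (by positivity)]
    simpa using hz

/-- **Hadamard factorization** for entire functions of order less than one. -/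
theorem Differentiable.hasProd_zeros {h : ℂ → ℂ} (hh : Differentiable ℂ h) (h0 : h 0 = 1)
    {C α : ℝ} (hC : 0 < C) (hα : α < 1)
    (hgrowth : ∀ R : ℝ, 1 ≤ R → ∀ z, ‖z‖ ≤ R → ‖h z‖ ≤ Real.exp (C * R ^ α)) (z : ℂ) :
    HasProd (fun i : ZeroIndex h => 1 - z / (i.1 : ℂ)) (h z) := by
  classical
  have h00 : h 0 ≠ 0 := by simp [h0]
  have hfin := hh.finite_zeros_closedBall h00
  set S : ℝ → Finset ℂ := fun R => (hfin R).toFinset with hSdef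
  have hmemS : ∀ R a, a ∈ S R ↔ h a = 0 ∧ ‖a‖ ≤ R := fun R a => by simp [hSdef]
  have hne : ∀ a, h a = 0 → a ≠ 0 := fun a ha e => h00 (e ▸ ha)
  set T : ℝ → Finset (ZeroIndex h) := fun R =>
    ((S R).subtype fun a => h a = 0).sigma fun _ => Finset.univ with hTdef
  have hmemT : ∀ R (i : ZeroIndex h), i ∈ T R ↔ ‖(i.1 : ℂ)‖ ≤ R := fun R i => by
    simp [hTdef, hmemS, i.1.2]
  have hprodT : ∀ R w, ∏ i ∈ T R, (1 - w / (i.1 : ℂ)) =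
      ∏ a ∈ S R, (1 - w / a) ^ analyticOrderNatAt h a := by
    intro R w
    rw [hTdef, Finset.prod_sigma]
    simp only [Finset.prod_const, Finset.card_univ, Fintype.card_fin]
    exact Finset.prod_subtype_of_mem (fun a => (1 - w / a) ^ analyticOrderNatAt h a)
      fun a ha => ((hmemS R a).1 ha).1
  have hcardT : ∀ R, (T R).card = ∑ a ∈ S R, analyticOrderNatAt h a := by
    intro R
    rw [hTdef, Finset.card_sigma]
    simp only [Finset.card_univ, Fintype.card_fin]
    exact Finset.sum_subtype_of_mem (fun a => analyticOrderNatAt h a)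
      fun a ha => ((hmemS R a).1 ha).1
  have hquot : ∀ R, ∃ g : ℂ → ℂ, Differentiable ℂ g ∧ (∀ a ∈ S R, g a ≠ 0) ∧
      ∀ w, h w = g w * ∏ a ∈ S R, (1 - w / a) ^ analyticOrderNatAt h a := fun R =>
    hh.exists_eq_mul_prod_zeros (hh.analyticOrderAt_ne_top h00) (S R) fun a ha =>
      hne a ((hmemS R a).1 ha).1
  choose g hg hgne hgh using hquot
  have hg0 : ∀ R, g R 0 = 1 := fun R => by simpa [h0] using (hgh R 0).symm
  have hmax : ∀ R, 1 ≤ R → ∀ w, ‖w‖ ≤ 4 * R →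
      ‖g R w‖ * Real.exp (T R).card ≤ Real.exp (C * (4 * R) ^ α) := by
    intro R hR w hw
    rw [hcardT]
    exact norm_mul_exp_le_of_eq_mul_prod (hg R) (by linarith)
      (fun a ha => ⟨hne a ((hmemS R a).1 ha).1, ((hmemS R a).1 ha).2⟩) (hgh R)
      (hgrowth (4 * R) (by linarith)) hw
  -- Jensen-type count: evaluate the bound at 0, where the quotient is 1.
  have hcount : ∀ R, 1 ≤ R → ((T R).card : ℝ) ≤ C * (4 * R) ^ α := by
    intro R hR
    have := hmax R hR 0 (by simp; linarith)
    rwa [hg0, norm_one, one_mul, Real.exp_le_exp] at this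
  -- the product converges absolutely
  have hsum : Summable fun i : ZeroIndex h => ‖(i.1 : ℂ)‖⁻¹ := by
    obtain ⟨δ, hδ, hball⟩ := Metric.eventually_nhds_iff_ball.1
      (hh.continuous.continuousAt.eventually_ne h00)
    refine summable_inv_of_card_le (C := C * 4 ^ α) hδ hα (fun i => ?_) fun R hR U hU => ?_
    · by_contra hlt
      exact hball i.1 (by simpa using hlt) i.1.2
    · have h1 : U ⊆ T R := fun i hi => (hmemT R i).2 (hU i hi)
      rw [mul_assoc, ← Real.mul_rpow (by norm_num) (by linarith)]
      exact le_trans (by exact_mod_cast Finset.card_le_card h1) (hcount R hR)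
  have hmult : Multipliable fun i : ZeroIndex h => 1 - z / (i.1 : ℂ) := by
    simp only [sub_eq_add_neg]
    refine multipliable_one_add_of_summable ?_
    simpa [norm_div, div_eq_mul_inv] using hsum.mul_left ‖z‖
  -- the products over discs tend to `h z`
  have hT : Tendsto T atTop atTop := by
    refine tendsto_atTop.2 fun U => ?_
    obtain ⟨B, hB⟩ := (U.image fun i => ‖(i.1 : ℂ)‖).bddAbove
    filter_upwards [eventually_ge_atTop B] with R hR i hi
    exact (hmemT R i).2 ((hB (Finset.mem_image_of_mem _ hi)).trans hR)
  have hlim : Tendsto (fun R => g R z) atTop (𝓝 1) := by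
    have hlog : ∀ R : ℝ, ∃ w : ℂ, 1 ≤ R → ‖z‖ < R →
        g R z = Complex.exp w ∧ ‖w‖ ≤ 2 * (C * (4 * R) ^ α) * ‖z‖ / (R - ‖z‖) := by
      intro R
      by_cases hR : 1 ≤ R ∧ ‖z‖ < R
      · obtain ⟨hR1, hzR⟩ := hR
        have hR0 : 0 < R := by linarith
        obtain ⟨w, hw⟩ := exists_log_norm_le_of_norm_le_exp (hg R) hR0
          (M := C * (4 * R) ^ α) (by positivity) (hg0 R)
          (fun x hx h0 => by
            have hxR : x ∈ S R := (hmemS R x).2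
              ⟨by rw [hgh R x, h0, zero_mul], by simpa using (mem_ball.1 hx).le⟩
            exact hgne R x hxR h0)
          (fun x hx => by
            have hx' : ‖x‖ < R := by simpa using hx
            refine le_trans ?_ (hmax R hR1 x (by linarith))
            exact le_mul_of_one_le_right (norm_nonneg _) (Real.one_le_exp (by positivity)))
          hzR
        exact ⟨w, fun _ _ => hw⟩
      -- A junk value for small R, so that the logarithm can be chosen as a function of all R.
      · exact ⟨0, fun h1 h2 => absurd ⟨h1, h2⟩ hR⟩
    choose w hw using hlog
    have hbound : Tendsto (fun R : ℝ => 2 * (C * (4 * R) ^ α) * ‖z‖ / (R - ‖z‖)) atTop (𝓝 0) := by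
      have h1 : Tendsto (fun R : ℝ => R ^ (α - 1)) atTop (𝓝 0) := by
        simpa using tendsto_rpow_neg_atTop (y := 1 - α) (by linarith)
      have h2 : Tendsto (fun R : ℝ => 4 * C * 4 ^ α * ‖z‖ * R ^ (α - 1)) atTop (𝓝 0) := by
        simpa using h1.const_mul (4 * C * 4 ^ α * ‖z‖)
      refine squeeze_zero' ?_ ?_ h2
      · filter_upwards [eventually_gt_atTop ‖z‖] with R hR
        have : 0 < R - ‖z‖ := by linarith
        have : 0 ≤ R := (norm_nonneg z).trans hR.le
        positivity
      · filter_upwards [eventually_gt_atTop (2 * ‖z‖), eventually_gt_atTop 0] with R hR hR0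
        have h3 : 0 < R - ‖z‖ := by linarith [norm_nonneg z]
        rw [div_le_iff₀ h3, Real.mul_rpow (by norm_num) hR0.le, Real.rpow_sub_one hR0.ne']
        have h4 : R ≤ 2 * (R - ‖z‖) := by linarith
        have h5 : 0 ≤ 2 * C * 4 ^ α * ‖z‖ * (R ^ α / R) := by positivity
        calc 2 * (C * (4 ^ α * R ^ α)) * ‖z‖
            = 2 * C * 4 ^ α * ‖z‖ * (R ^ α / R) * R := by field_simp
          _ ≤ 2 * C * 4 ^ α * ‖z‖ * (R ^ α / R) * (2 * (R - ‖z‖)) := by gcongr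
          _ = _ := by ring
    have hw0 : Tendsto w atTop (𝓝 0) := by
      refine squeeze_zero_norm' ?_ hbound
      filter_upwards [eventually_ge_atTop 1, eventually_gt_atTop ‖z‖] with R h1 h2
      exact (hw R h1 h2).2
    have hexp : Tendsto (fun R => Complex.exp (w R)) atTop (𝓝 1) := by
      simpa [Function.comp_def] using (Complex.continuous_exp.tendsto 0).comp hw0
    refine hexp.congr' ?_
    filter_upwards [eventually_ge_atTop 1, eventually_gt_atTop ‖z‖] with R h1 h2
    exact (hw R h1 h2).1.symm
  have hP := hmult.hasProd
  have hP' : Tendsto (fun U : Finset (ZeroIndex h) => ∏ i ∈ U, (1 - z / (i.1 : ℂ))) atTop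
      (𝓝 (∏' i : ZeroIndex h, (1 - z / (i.1 : ℂ)))) := by simpa [HasProd] using hP
  have hPT : Tendsto (fun R => ∏ i ∈ T R, (1 - z / (i.1 : ℂ))) atTop
      (𝓝 (∏' i : ZeroIndex h, (1 - z / (i.1 : ℂ)))) :=  hP'.comp hT
  have heq : h z = ∏' i : ZeroIndex h, (1 - z / (i.1 : ℂ)) := by
    have h1 := hlim.mul hPT
    rw [one_mul] at h1
    refine tendsto_nhds_unique (tendsto_const_nhds (x := h z) (f := atTop)) (h1.congr fun R => ?_)
    rw [hprodT, ← hgh]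
  rw [heq]
  exact hP

/-! ### Growth of the completed zeta function -/

/-- The Mellin transform of a nonnegative function is bounded on vertical strips by its values at
the real points of the edges. -/
theorem norm_mellin_le_add {F : ℝ → ℝ} (hF : ∀ t, 0 < t → 0 ≤ F t) {a b : ℝ} {s : ℂ}
    (ha : a ≤ s.re) (hb : s.re ≤ b)
    (hca : MellinConvergent (fun t => (F t : ℂ)) a)
    (hcb : MellinConvergent (fun t => (F t : ℂ)) b) :
    ‖mellin (fun t => (F t : ℂ)) s‖ ≤
      ‖mellin (fun t => (F t : ℂ)) a‖ + ‖mellin (fun t => (F t : ℂ)) b‖ := by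
  have hnorm : ∀ (r : ℂ) (t : ℝ), t ∈ Set.Ioi (0 : ℝ) →
      ‖(t : ℂ) ^ (r - 1) • (F t : ℂ)‖ = t ^ (r.re - 1) * F t := by
    intro r t ht
    rw [norm_smul, Complex.norm_cpow_eq_rpow_re_of_pos ht, Complex.norm_real,
      Real.norm_of_nonneg (hF t ht)]
    simp
  have hreal : ∀ r : ℝ, ‖mellin (fun t => (F t : ℂ)) r‖ =
      ∫ t in Set.Ioi (0 : ℝ), t ^ (r - 1) * F t := by
    intro r
    have h1 : mellin (fun t => (F t : ℂ)) r =
        ((∫ t in Set.Ioi (0 : ℝ), t ^ (r - 1) * F t : ℝ) : ℂ) := by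
      rw [mellin, ← integral_complex_ofReal]
      refine MeasureTheory.setIntegral_congr_fun measurableSet_Ioi fun t ht => ?_
      have ht' : (0 : ℝ) ≤ t := le_of_lt ht
      simp [Complex.ofReal_cpow ht']
    rw [h1, Complex.norm_real, Real.norm_of_nonneg]
    refine MeasureTheory.setIntegral_nonneg measurableSet_Ioi fun t ht => ?_
    exact mul_nonneg (Real.rpow_nonneg (le_of_lt ht) _) (hF t ht)
  have hintegrable : ∀ r : ℝ, MellinConvergent (fun t => (F t : ℂ)) r →
      MeasureTheory.IntegrableOn (fun t : ℝ => t ^ (r - 1) * F t) (Set.Ioi 0) := by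
    intro r hr
    refine MeasureTheory.IntegrableOn.congr_fun hr.norm (fun t ht => ?_) measurableSet_Ioi
    simpa using hnorm r t ht
  rw [hreal, hreal, ← MeasureTheory.integral_add (hintegrable a hca) (hintegrable b hcb), mellin]
  refine MeasureTheory.norm_integral_le_of_norm_le ((hintegrable a hca).add (hintegrable b hcb)) ?_
  refine (MeasureTheory.ae_restrict_iff' measurableSet_Ioi).2 (Eventually.of_forall fun t ht => ?_)
  rw [hnorm s t ht]
  have ht0 : 0 < t := ht
  have hFt := hF t ht
  rw [← add_mul]
  refine mul_le_mul_of_nonneg_right ?_ hFt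
  have h1 : 0 < t ^ (a - 1) := Real.rpow_pos_of_pos ht0 _
  have h2 : 0 < t ^ (b - 1) := Real.rpow_pos_of_pos ht0 _
  -- The power of t is dominated by the right edge for t ≥ 1 and by the left edge for t ≤ 1.
  rcases le_total 1 t with h | h
  · have := Real.rpow_le_rpow_of_exponent_le h (by linarith : s.re - 1 ≤ b - 1)
    linarith
  · have := Real.rpow_le_rpow_of_exponent_ge ht0 h (by linarith : a - 1 ≤ s.re - 1)
    linarith

theorem HurwitzZeta.one_le_evenKernel_zero {t : ℝ} (ht : 0 < t) :
    1 ≤ HurwitzZeta.evenKernel 0 t := by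
  have h := HurwitzZeta.hasSum_int_evenKernel₀ 0 ht
  have h1 := h.nonneg fun n => by split_ifs <;> positivity
  simpa using h1

/-- For t > 1 the modified kernel is θ(t) - 1 ≥ 0; the functional equation of the self-dual pair
carries the sign to t < 1. -/
theorem HurwitzZeta.f_modif_hurwitzEvenFEPair_zero {t : ℝ} (ht : 0 < t) :
    ∃ r : ℝ, 0 ≤ r ∧ (HurwitzZeta.hurwitzEvenFEPair 0).f_modif t = r := by
  have hgt : ∀ x : ℝ, 1 < x → ∃ r : ℝ, 0 ≤ r ∧
      (HurwitzZeta.hurwitzEvenFEPair 0).f_modif x = r := by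
    intro x hx
    refine ⟨HurwitzZeta.evenKernel 0 x - 1,
      sub_nonneg.2 (HurwitzZeta.one_le_evenKernel_zero (by linarith)), ?_⟩
    simp [WeakFEPair.f_modif, Set.indicator, hx, hx.not_gt, HurwitzZeta.hurwitzEvenFEPair]
  rcases lt_trichotomy 1 t with h | rfl | h
  · exact hgt t h
  -- The modified kernel is built from indicators of open intervals and so vanishes at t = 1.
  · exact ⟨0, le_rfl, by simp [WeakFEPair.f_modif]⟩
  · have hinv : 1 < 1 / t := by rwa [lt_one_div one_pos ht, div_one]
    obtain ⟨r, hr, hrt⟩ := hgt (1 / t) hinv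
    have hFE := (HurwitzZeta.hurwitzEvenFEPair 0).symm.hf_modif_FE (1 / t) (by positivity)
    rw [one_div_one_div] at hFE
    have hg : (HurwitzZeta.hurwitzEvenFEPair 0).symm.g_modif =
      (HurwitzZeta.hurwitzEvenFEPair 0).f_modif := by
      simp [WeakFEPair.f_modif, WeakFEPair.g_modif, -HurwitzZeta.hurwitzEvenFEPair_zero_symm]
    rw [hg, hrt, HurwitzZeta.hurwitzEvenFEPair_zero_symm] at hFE
    refine ⟨(1 / t) ^ (1 / 2 : ℝ) * r, by positivity, ?_⟩
    rw [hFE]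
    simp [HurwitzZeta.hurwitzEvenFEPair]

theorem norm_completedRiemannZeta₀_le_add {a b : ℝ} {s : ℂ} (ha : a ≤ s.re) (hb : s.re ≤ b) :
    ‖completedRiemannZeta₀ s‖ ≤ ‖completedRiemannZeta₀ a‖ + ‖completedRiemannZeta₀ b‖ := by
  set P := HurwitzZeta.hurwitzEvenFEPair 0
  set F : ℝ → ℝ := fun t => (P.f_modif t).re
  have hF : ∀ t, 0 < t → 0 ≤ F t ∧ P.f_modif t = F t := fun t ht => by
    obtain ⟨r, hr, hrt⟩ := HurwitzZeta.f_modif_hurwitzEvenFEPair_zero ht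
    simp only [F, P, hrt, Complex.ofReal_re]
    exact ⟨hr, trivial⟩
  have hmellin : ∀ s, mellin (fun t => (F t : ℂ)) s = P.Λ₀ s := fun s =>
    MeasureTheory.setIntegral_congr_fun measurableSet_Ioi fun t ht => by
      simp only [← (hF t ht).2]
  have hconv : ∀ s : ℂ, MellinConvergent (fun t => (F t : ℂ)) s := fun s =>
    MeasureTheory.IntegrableOn.congr_fun (P.isStrongFEPair_toStrongFEPair.hasMellin s).1
      (fun t ht => by
        change _ = _ • (F t : ℂ)
        rw [← (hF t ht).2]
        rfl) measurableSet_Ioi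
  have hΛ : ∀ s, completedRiemannZeta₀ s = P.Λ₀ (s / 2) / 2 := fun _ => rfl
  have h := norm_mellin_le_add (fun t ht => (hF t ht).1) (a := a / 2) (b := b / 2) (s := s / 2)
    (by simpa using by linarith) (by simpa using by linarith) (hconv _) (hconv _)
  simp only [hmellin] at h
  push_cast at h
  simp only [hΛ, norm_div, Complex.norm_ofNat]
  linarith

/-- The constant 4 is what excludes zeros of ξ in [0, 1]: there x(1-x) ≤ 1/4, so x(1-x)Λ₀(x) cannot
equal 1. The edge values at 0 and 1 agree by symmetry and are explicit. -/
theorem norm_completedRiemannZeta₀_lt_four {s : ℂ} (h0 : 0 ≤ s.re) (h1 : s.re ≤ 1) :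
    ‖completedRiemannZeta₀ s‖ < 4 := by
  have h := norm_completedRiemannZeta₀_le_add (a := 0) (b := 1) h0 h1
  have hsymm : completedRiemannZeta₀ 0 = completedRiemannZeta₀ 1 := by
    simpa using completedRiemannZeta₀_one_sub 1
  have hval : completedRiemannZeta₀ 1 =
      (((Real.eulerMascheroniConstant - Real.log (4 * Real.pi)) / 2 + 1 : ℝ) : ℂ) := by
    rw [completedRiemannZeta₀_one]
    push_cast [Complex.ofReal_log (by positivity : (0 : ℝ) ≤ 4 * Real.pi)]
    rfl
  have hlt : ‖completedRiemannZeta₀ 1‖ < 2 := by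
    rw [hval, Complex.norm_real, Real.norm_eq_abs, abs_lt]
    have hγ := Real.eulerMascheroniConstant_lt_two_thirds
    have hγ' := Real.one_half_lt_eulerMascheroniConstant
    have hlog : 0 ≤ Real.log (4 * Real.pi) := Real.log_nonneg (by linarith [Real.pi_gt_three])
    have hlog' : Real.log (4 * Real.pi) ≤ 6 := by
      have h4 : Real.log 4 = 2 * Real.log 2 := by
        rw [← Real.log_rpow (by norm_num)]; norm_num
      rw [Real.log_mul (by norm_num) Real.pi_ne_zero, h4]
      linarith [Real.log_two_lt_d9, Real.log_le_sub_one_of_pos Real.pi_pos, Real.pi_lt_four]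
    constructor <;> linarith
  push_cast at h
  rw [hsymm] at h
  linarith

theorem norm_riemannZeta_natCast_le {n : ℕ} (hn : 2 ≤ n) : ‖riemannZeta n‖ ≤ Real.pi ^ 2 / 6 := by
  have hsumm : Summable fun k : ℕ => 1 / (k : ℝ) ^ 2 := hasSum_zeta_two.summable
  rw [zeta_nat_eq_tsum_of_gt_one hn, ← hasSum_zeta_two.tsum_eq]
  refine tsum_of_norm_bounded hsumm.hasSum fun k => ?_
  rw [norm_div, norm_one, norm_pow, Complex.norm_natCast]
  rcases Nat.eq_zero_or_pos k with rfl | hk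
  · simp [show n ≠ 0 by omega]
  · have : (1 : ℝ) ≤ k := by exact_mod_cast hk
    gcongr

/-- The Gamma factor at 2k is π^(-k) (k-1)!, ζ(2k) is at most 4, and each polar term is at most 1;
the total 4 k! + 2 is at most 6 k!. -/
theorem norm_completedRiemannZeta₀_two_mul_le {k : ℕ} (hk : 1 ≤ k) :
    ‖completedRiemannZeta₀ (2 * k : ℕ)‖ ≤ 6 * k.factorial := by
  have hk1 : (1 : ℝ) ≤ k := by exact_mod_cast hk
  have h0 : ((2 * k : ℕ) : ℂ) ≠ 0 := by
    exact_mod_cast (by omega : 2 * k ≠ 0)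
  have hΓ : Complex.Gammaℝ (2 * k : ℕ) ≠ 0 := Complex.Gammaℝ_ne_zero_of_re_pos (by
    rw [Complex.natCast_re]; exact_mod_cast (by omega : 0 < 2 * k))
  have hΛ : completedRiemannZeta (2 * k : ℕ) =
      riemannZeta (2 * k : ℕ) * Complex.Gammaℝ (2 * k : ℕ) := by
    rw [riemannZeta_def_of_ne_zero h0, div_mul_cancel₀ _ hΓ]
  have hG : ‖Complex.Gammaℝ (2 * k : ℕ)‖ ≤ k.factorial := by
    have h1 : ((2 * k : ℕ) : ℂ) / 2 = ((k - 1 : ℕ) : ℂ) + 1 := by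
      push_cast [Nat.cast_sub hk]; ring
    rw [Complex.Gammaℝ_def, norm_mul, h1, Complex.Gamma_nat_eq_factorial, Complex.norm_natCast,
      Complex.norm_cpow_eq_rpow_re_of_pos Real.pi_pos]
    have h2 : Real.pi ^ (-((2 * k : ℕ) : ℂ) / 2).re ≤ 1 := by
      refine Real.rpow_le_one_of_one_le_of_nonpos (by linarith [Real.pi_gt_three]) ?_
      simpa using by linarith
    have h3 : ((k - 1).factorial : ℝ) ≤ k.factorial := by
      exact_mod_cast Nat.factorial_le (Nat.sub_le k 1)
    calc _ ≤ 1 * ((k - 1).factorial : ℝ) := by gcongr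
      _ ≤ _ := by simpa using h3
  have heq := completedRiemannZeta_eq (2 * k : ℕ)
  have h4 : completedRiemannZeta₀ (2 * k : ℕ) = riemannZeta (2 * k : ℕ) *
      Complex.Gammaℝ (2 * k : ℕ) + 1 / (2 * k : ℕ) + 1 / (1 - (2 * k : ℕ)) := by
    rw [← hΛ, heq]; ring
  have hfac : (1 : ℝ) ≤ k.factorial := by exact_mod_cast Nat.succ_le_of_lt k.factorial_pos
  have hζ : ‖riemannZeta (2 * k : ℕ)‖ ≤ 4 := by
    refine (norm_riemannZeta_natCast_le (by omega)).trans ?_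
    nlinarith [Real.pi_lt_four, Real.pi_pos]
  have h5 : ‖(1 : ℂ) / (2 * k : ℕ)‖ ≤ 1 := by
    rw [norm_div, norm_one, Complex.norm_natCast]
    refine div_le_one_of_le₀ ?_ (by positivity)
    push_cast; linarith
  have h6 : ‖(1 : ℂ) / (1 - (2 * k : ℕ))‖ ≤ 1 := by
    have : (1 - ((2 * k : ℕ) : ℂ)) = ((1 - 2 * k : ℝ) : ℂ) := by push_cast; ring
    rw [this, norm_div, norm_one, Complex.norm_real, Real.norm_eq_abs]
    refine div_le_one_of_le₀ ?_ (by positivity)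
    rw [abs_of_nonpos (by linarith)]; linarith
  rw [h4]
  calc _ ≤ ‖riemannZeta (2 * k : ℕ) * Complex.Gammaℝ (2 * k : ℕ)‖ + ‖(1 : ℂ) / (2 * k : ℕ)‖ +
        ‖(1 : ℂ) / (1 - (2 * k : ℕ))‖ := norm_add₃_le
    _ ≤ 4 * k.factorial + 1 + 1 := by
        gcongr
        rw [norm_mul]
        gcongr
    _ ≤ _ := by linarith

/-- The disc lies in the strip 1-2k ≤ Re s ≤ 2k, whose two real edge points are exchanged by s ↦
1-s. -/
theorem norm_completedRiemannZeta₀_le_factorial {k : ℕ} (hk : 1 ≤ k) {s : ℂ}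
    (hs : ‖s‖ ≤ 2 * k - 1) : ‖completedRiemannZeta₀ s‖ ≤ 12 * k.factorial := by
  have hre := (abs_le.1 (Complex.abs_re_le_norm s))
  have h := norm_completedRiemannZeta₀_le_add (a := 1 - 2 * k) (b := 2 * k) (s := s)
    (by linarith [hre.1]) (by linarith [hre.2])
  have h1 := norm_completedRiemannZeta₀_two_mul_le hk
  have h2 : completedRiemannZeta₀ ((1 - 2 * k : ℝ) : ℂ) = completedRiemannZeta₀ (2 * k : ℕ) := by
    rw [← completedRiemannZeta₀_one_sub]; congr 1; push_cast; ring
  have h3 : (((2 * k : ℝ)) : ℂ) = (2 * k : ℕ) := by push_cast; ring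
  rw [h2, h3] at h
  linarith

/-- The exponent 3/2 absorbs the logarithm in k log k, yet stays below 2, so that it falls below 1
when halved by passing to s(1-s). -/
theorem Nat.factorial_le_exp_rpow (k : ℕ) :
    (k.factorial : ℝ) ≤ Real.exp (2 * (k : ℝ) ^ (3 / 2 : ℝ)) := by
  rcases Nat.eq_zero_or_pos k with rfl | hk
  · simp
  have hk0 : (0 : ℝ) < k := by exact_mod_cast hk
  calc (k.factorial : ℝ) ≤ (k : ℝ) ^ k := by exact_mod_cast Nat.factorial_le_pow k
    _ = Real.exp (k * Real.log k) := by
        rw [Real.exp_nat_mul, Real.exp_log hk0]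
    _ ≤ _ := by
        refine Real.exp_le_exp.2 ?_
        have h1 := Real.log_le_rpow_div hk0.le (by norm_num : (0 : ℝ) < 1 / 2)
        have h2 : (k : ℝ) ^ (3 / 2 : ℝ) = k * (k : ℝ) ^ (1 / 2 : ℝ) := by
          rw [← Real.rpow_one_add' hk0.le (by norm_num)]; norm_num
        rw [h2]
        calc (k : ℝ) * Real.log k ≤ k * ((k : ℝ) ^ (1 / 2 : ℝ) / (1 / 2)) := by gcongr
          _ = _ := by ring

theorem norm_completedRiemannZeta₀_le_exp {A : ℝ} (hA : 1 ≤ A) {s : ℂ} (hs : ‖s‖ ≤ A) :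
    ‖completedRiemannZeta₀ s‖ ≤ Real.exp (18 * A ^ (3 / 2 : ℝ)) := by
  set k : ℕ := ⌈A⌉₊
  have hk : 1 ≤ k := Nat.one_le_ceil_iff.2 (by linarith)
  have hAk : A ≤ k := Nat.le_ceil A
  have hkA : (k : ℝ) ≤ 2 * A := by
    have := Nat.ceil_lt_add_one (show 0 ≤ A by linarith)
    linarith
  have hk1 : (1 : ℝ) ≤ k := by exact_mod_cast hk
  have h1 := norm_completedRiemannZeta₀_le_factorial hk (s := s) (by linarith)
  have h2 := Nat.factorial_le_exp_rpow k
  have hA32 : 1 ≤ A ^ (3 / 2 : ℝ) := Real.one_le_rpow hA (by norm_num)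
  have h3 : (k : ℝ) ^ (3 / 2 : ℝ) ≤ 4 * A ^ (3 / 2 : ℝ) := by
    calc (k : ℝ) ^ (3 / 2 : ℝ) ≤ (2 * A) ^ (3 / 2 : ℝ) := by gcongr
      _ = 2 ^ (3 / 2 : ℝ) * A ^ (3 / 2 : ℝ) := Real.mul_rpow (by norm_num) (by linarith)
      _ ≤ 2 ^ (2 : ℝ) * A ^ (3 / 2 : ℝ) := by
          gcongr
          · norm_num
          · norm_num
      _ = _ := by norm_num
  have h12 : (12 : ℝ) ≤ Real.exp (10 * A ^ (3 / 2 : ℝ)) := by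
    have h5 := Real.quadratic_le_exp_of_nonneg (show 0 ≤ 10 * A ^ (3 / 2 : ℝ) by positivity)
    nlinarith
  -- The constant 18 is 10, absorbing the factor 12, plus 2 · 4 from the factorial with k ≤ 2A.
  calc _ ≤ 12 * (k.factorial : ℝ) := h1
    _ ≤ Real.exp (10 * A ^ (3 / 2 : ℝ)) * Real.exp (2 * (k : ℝ) ^ (3 / 2 : ℝ)) := by gcongr
    _ = Real.exp (10 * A ^ (3 / 2 : ℝ) + 2 * (k : ℝ) ^ (3 / 2 : ℝ)) := (Real.exp_add _ _).symm
    _ ≤ _ := Real.exp_le_exp.2 (by linarith)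

/-! ### The xi function as a function of s(1-s) -/

/-- An even entire function is an entire function of the square of the variable. -/
theorem Differentiable.exists_eq_comp_sq {F : ℂ → ℂ} (hF : Differentiable ℂ F)
    (heven : ∀ w, F (-w) = F w) :
    ∃ H : ℂ → ℂ, Differentiable ℂ H ∧ ∀ w, F w = H (w ^ 2) := by
  have hroot : ∀ z : ℂ, (z ^ (2⁻¹ : ℂ)) ^ 2 = z := fun z => by
    simp
  have hkey : ∀ w v : ℂ, w ^ 2 = v ^ 2 → F w = F v := by
    intro w v h
    rcases sq_eq_sq_iff_eq_or_eq_neg.1 h with rfl | rfl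
    · rfl
    · exact heven v
  have hdiff : ∀ z : ℂ, z ≠ 0 → DifferentiableAt ℂ (fun z => F (z ^ (2⁻¹ : ℂ))) z := by
    intro z hz
    by_cases hs : z ∈ Complex.slitPlane
    · exact (hF _).comp z (differentiableAt_id.cpow_const hs)
    · have hs' : -z ∈ Complex.slitPlane := by
        rw [Complex.mem_slitPlane_iff] at hs ⊢
        push Not at hs
        refine Or.inl (lt_of_le_of_ne (by simpa using hs.1) fun h => hz ?_)
        exact Complex.ext (by simpa using h.symm) hs.2
      -- Off the slit plane use the square root i(-z)^(1/2), holomorphic there; evenness makes the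
      -- choice of root irrelevant.
      have heq : (fun z => F (z ^ (2⁻¹ : ℂ))) =
          fun z => F (Complex.I * (-z) ^ (2⁻¹ : ℂ)) := by
        funext y
        refine hkey _ _ ?_
        rw [mul_pow, hroot, hroot, Complex.I_sq]
        ring
      rw [heq]
      exact (hF _).comp z
        ((differentiableAt_id.neg.cpow_const hs').const_mul Complex.I)
  refine ⟨fun z => F (z ^ (2⁻¹ : ℂ)), fun z => ?_, fun w => hkey _ _ (hroot _).symm⟩
  rcases eq_or_ne z 0 with rfl | hz
  -- At the branch point continuity suffices, by removability of the singularity.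
  · refine AnalyticAt.differentiableAt
      (Complex.analyticAt_of_differentiable_on_punctured_nhds_of_continuousAt ?_ ?_)
    · filter_upwards [self_mem_nhdsWithin] with z hz using hdiff z hz
    · refine hF.continuous.continuousAt.comp ?_
      exact Complex.continuousAt_cpow_zero_of_re_pos (by norm_num) |>.comp
        (f := fun z : ℂ => (z, (2⁻¹ : ℂ))) (by fun_prop)
  · exact hdiff z hz

/-- The Riemann xi function, normalised to have the value `1` at `0`. -/
noncomputable def normalizedXi (s : ℂ) : ℂ := 1 - s * (1 - s) * completedRiemannZeta₀ s

theorem differentiable_normalizedXi : Differentiable ℂ normalizedXi := by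
  have := differentiable_completedZeta₀
  unfold normalizedXi
  fun_prop

theorem normalizedXi_one_sub (s : ℂ) : normalizedXi (1 - s) = normalizedXi s := by
  rw [normalizedXi, normalizedXi, completedRiemannZeta₀_one_sub]
  ring

theorem normalizedXi_eq {s : ℂ} (h0 : s ≠ 0) (h1 : s ≠ 1) :
    normalizedXi s = s * (s - 1) * completedRiemannZeta s := by
  have h1' : 1 - s ≠ 0 := sub_ne_zero.2 h1.symm
  rw [normalizedXi, completedRiemannZeta_eq]
  field_simp
  ring

theorem riemannZeta_eq_mul_normalizedXi {s : ℂ} (h0 : s ≠ 0) (h1 : s ≠ 1) :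
    riemannZeta s = (s * (s - 1))⁻¹ * (Complex.Gammaℝ s)⁻¹ * normalizedXi s := by
  have h1' : s - 1 ≠ 0 := sub_ne_zero.2 h1
  rw [normalizedXi_eq h0 h1, riemannZeta_def_of_ne_zero h0]
  field_simp

theorem Complex.Gammaℝ_ne_zero_of_im_ne_zero {s : ℂ} (hs : s.im ≠ 0) : Complex.Gammaℝ s ≠ 0 := by
  rw [Ne, Complex.Gammaℝ_eq_zero_iff]
  rintro ⟨n, rfl⟩
  simp at hs

theorem normalizedXi_eq_zero_iff {s : ℂ} (hs : s.im ≠ 0) :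
    normalizedXi s = 0 ↔ riemannZeta s = 0 := by
  have h0 : s ≠ 0 := by rintro rfl; simp at hs
  have h1 : s ≠ 1 := by rintro rfl; simp at hs
  rw [riemannZeta_eq_mul_normalizedXi h0 h1]
  simp [h0, sub_ne_zero.2 h1, Complex.Gammaℝ_ne_zero_of_im_ne_zero hs]

/-- All zeros of the Riemann xi function are non-real. -/
theorem im_ne_zero_of_normalizedXi_eq_zero {s : ℂ} (hs : normalizedXi s = 0) : s.im ≠ 0 := by
  intro him
  obtain ⟨x, rfl⟩ : ∃ x : ℝ, s = x := ⟨s.re, Complex.ext rfl (by simpa using him)⟩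
  have hgt : ∀ y : ℝ, 1 < y → normalizedXi y ≠ 0 := by
    intro y hy h
    have h0 : (y : ℂ) ≠ 0 := by exact_mod_cast (by linarith : y ≠ 0)
    have h1 : (y : ℂ) ≠ 1 := by exact_mod_cast hy.ne'
    refine riemannZeta_ne_zero_of_one_lt_re (s := y) (by simpa using hy) ?_
    rw [riemannZeta_eq_mul_normalizedXi h0 h1, h, mul_zero]
  rcases lt_or_ge 1 x with h1 | h1
  · exact hgt x h1 hs
  rcases lt_or_ge x 0 with h0 | h0
  · refine hgt (1 - x) (by linarith) ?_
    push_cast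
    rw [normalizedXi_one_sub, hs]
  have hlt := norm_completedRiemannZeta₀_lt_four (s := x) (by simpa using h0) (by simpa using h1)
  have heq : (x : ℂ) * (1 - x) * completedRiemannZeta₀ x = 1 := (sub_eq_zero.1 hs).symm
  have hnorm := congrArg norm heq
  have hx : (x : ℂ) * (1 - x) = ((x * (1 - x) : ℝ) : ℂ) := by push_cast; ring
  have hx0 : 0 ≤ x * (1 - x) := mul_nonneg h0 (by linarith)
  rw [norm_mul, hx, Complex.norm_real, Real.norm_of_nonneg hx0, norm_one] at hnorm
  nlinarith [sq_nonneg (2 * x - 1), norm_nonneg (completedRiemannZeta₀ x)]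

theorem exists_mul_one_sub_eq (z : ℂ) : ∃ s : ℂ, s * (1 - s) = z := by
  obtain ⟨w, hw⟩ := IsAlgClosed.exists_pow_nat_eq (1 / 4 - z) two_pos
  exact ⟨1 / 2 + w, by linear_combination -hw⟩

/-- The Riemann xi function is an entire function of `s * (1 - s)`. -/
theorem exists_normalizedXi_eq_comp :
    ∃ h : ℂ → ℂ, Differentiable ℂ h ∧ ∀ s, normalizedXi s = h (s * (1 - s)) := by
  obtain ⟨H, hH, hF⟩ := Differentiable.exists_eq_comp_sq (F := fun w => normalizedXi (1 / 2 + w))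
    (differentiable_normalizedXi.comp (by fun_prop)) fun w => by
      rw [← normalizedXi_one_sub]; congr 1; ring
  refine ⟨fun z => H (1 / 4 - z), hH.comp (by fun_prop), fun s => ?_⟩
  have := hF (s - 1 / 2)
  rw [add_sub_cancel] at this
  rw [this]
  congr 1
  ring

/-- From |s|(|s|-1) ≤ R follows |s| ≤ 2√R, which halves the exponent 3/2. The constant 74 is 18 · 4
plus 2 for the factor 1 + R. -/
theorem norm_normalizedXi_le {R : ℝ} (hR : 1 ≤ R) {s : ℂ} (hs : ‖s * (1 - s)‖ ≤ R) :
    ‖normalizedXi s‖ ≤ Real.exp (74 * R ^ (3 / 4 : ℝ)) := by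
  have hR0 : 0 ≤ R := by linarith
  have hsqrt : 1 ≤ √R := Real.one_le_sqrt.2 hR
  have hsnorm : ‖s‖ ≤ 2 * √R := by
    have h1 : ‖s‖ * ‖1 - s‖ ≤ √R ^ 2 := by rwa [Real.sq_sqrt hR0, ← norm_mul]
    have h2 : ‖s‖ - 1 ≤ ‖1 - s‖ := by
      have := norm_sub_norm_le s 1
      rwa [norm_one, norm_sub_rev] at this
    nlinarith [norm_nonneg s, norm_nonneg (1 - s)]
  have hΛ := norm_completedRiemannZeta₀_le_exp (A := 2 * √R) (by linarith) hsnorm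
  have hpow : (2 * √R) ^ (3 / 2 : ℝ) ≤ 4 * R ^ (3 / 4 : ℝ) := by
    rw [Real.mul_rpow (by norm_num) (by positivity), Real.sqrt_eq_rpow, ← Real.rpow_mul hR0]
    have h2 : (2 : ℝ) ^ (3 / 2 : ℝ) ≤ 4 := by
      calc (2 : ℝ) ^ (3 / 2 : ℝ) ≤ 2 ^ (2 : ℝ) :=
            Real.rpow_le_rpow_of_exponent_le one_le_two (by norm_num)
        _ = 4 := by norm_num
    norm_num at h2 ⊢
    gcongr
  have hE : ‖completedRiemannZeta₀ s‖ ≤ Real.exp (72 * R ^ (3 / 4 : ℝ)) :=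
    hΛ.trans (Real.exp_le_exp.2 (by linarith))
  have hE1 : 1 ≤ Real.exp (72 * R ^ (3 / 4 : ℝ)) := Real.one_le_exp (by positivity)
  have hRexp : 1 + R ≤ Real.exp (2 * R ^ (3 / 4 : ℝ)) := by
    have h1 := Real.quadratic_le_exp_of_nonneg (show 0 ≤ 2 * R ^ (3 / 4 : ℝ) by positivity)
    have h2 : R ≤ (R ^ (3 / 4 : ℝ)) ^ 2 := by
      rw [← Real.rpow_natCast, ← Real.rpow_mul hR0]
      exact Real.self_le_rpow_of_one_le hR (by norm_num)
    have h3 : 0 ≤ R ^ (3 / 4 : ℝ) := by positivity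
    nlinarith
  calc ‖normalizedXi s‖ ≤ ‖(1 : ℂ)‖ + ‖s * (1 - s) * completedRiemannZeta₀ s‖ := norm_sub_le _ _
    _ ≤ 1 + R * Real.exp (72 * R ^ (3 / 4 : ℝ)) := by
        rw [norm_one, norm_mul]
        gcongr
    _ ≤ (1 + R) * Real.exp (72 * R ^ (3 / 4 : ℝ)) := by nlinarith
    _ ≤ Real.exp (2 * R ^ (3 / 4 : ℝ)) * Real.exp (72 * R ^ (3 / 4 : ℝ)) := by gcongr
    _ = _ := by rw [← Real.exp_add]; congr 1; ring

/-- Off the real axis ζ and ξ differ by an analytic factor without zeros. -/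
theorem analyticOrderAt_riemannZeta_eq {ρ : ℂ} (hρ : ρ.im ≠ 0) :
    analyticOrderAt riemannZeta ρ = analyticOrderAt normalizedXi ρ := by
  have h0 : ρ ≠ 0 := by rintro rfl; simp at hρ
  have h1 : ρ ≠ 1 := by rintro rfl; simp at hρ
  have heq : riemannZeta =ᶠ[𝓝 ρ]
      (fun s => (s * (s - 1))⁻¹ * (Complex.Gammaℝ s)⁻¹) * normalizedXi := by
    filter_upwards [eventually_ne_nhds h0, eventually_ne_nhds h1] with s hs0 hs1
    exact riemannZeta_eq_mul_normalizedXi hs0 hs1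
  have hne : ρ * (ρ - 1) ≠ 0 := mul_ne_zero h0 (sub_ne_zero.2 h1)
  have hA : AnalyticAt ℂ (fun s => (s * (s - 1))⁻¹ * (Complex.Gammaℝ s)⁻¹) ρ :=
    AnalyticAt.mul (AnalyticAt.inv (by fun_prop) hne)
      (Complex.differentiable_Gammaℝ_inv.analyticAt ρ)
  rw [analyticOrderAt_congr heq,
    analyticOrderAt_mul hA (differentiable_normalizedXi.analyticAt ρ),
    hA.analyticOrderAt_eq_zero.2 (mul_ne_zero (inv_ne_zero hne)
      (inv_ne_zero (Complex.Gammaℝ_ne_zero_of_im_ne_zero hρ))), zero_add]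

theorem zetaZeroFactor_eq {s ρ : ℂ} (hρ : ρ.im ≠ 0) :
    zetaZeroFactor s ρ = 1 - s * (1 - s) / (ρ * (1 - ρ)) := by
  have h0 : ρ ≠ 0 := by rintro rfl; simp at hρ
  have h1 : 1 - ρ ≠ 0 := by
    intro h
    rw [← sub_eq_zero.1 h] at hρ
    simp at hρ
  rw [zetaZeroFactor]
  field_simp
  ring

/-! ### The product over the zeros of zeta -/

/-- The Riemann xi function is the product over its pairs of symmetric zeros. -/
theorem hasProd_zetaZeroFactor (s : ℂ) :
    HasProd (fun i : UpperZetaZeroIndex => zetaZeroFactor s (i.1 : ℂ)) (normalizedXi s) := by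
  obtain ⟨h, hh, hxi⟩ := exists_normalizedXi_eq_comp
  have h0 : h 0 = 1 := by simpa [normalizedXi] using (hxi 0).symm
  have hprod := hh.hasProd_zeros h0 (C := 74) (α := 3 / 4) (by norm_num) (by norm_num)
    (fun R hR z hz => by
      obtain ⟨t, rfl⟩ := exists_mul_one_sub_eq z
      rw [← hxi]
      exact norm_normalizedXi_le hR hz) (s * (1 - s))
  rw [← hxi] at hprod
  let f : upperZetaZeros → {a : ℂ // h a = 0} := fun ρ => ⟨ρ * (1 - ρ), by
    rw [← hxi]
    exact (normalizedXi_eq_zero_iff ρ.2.2.ne').2 ρ.2.1⟩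
  have hf : Function.Bijective f := by
    constructor
    · intro ρ σ hρσ
      have h1 : (ρ : ℂ) * (1 - ρ) = σ * (1 - σ) := congrArg Subtype.val hρσ
      have h2 : ((ρ : ℂ) - σ) * (1 - ρ - σ) = 0 := by linear_combination h1
      rcases mul_eq_zero.1 h2 with h3 | h3
      · exact Subtype.ext (sub_eq_zero.1 h3)
      -- The other preimage σ = 1-ρ lies in the lower half-plane.
      · have h4 := congrArg Complex.im h3
        simp only [Complex.sub_im, Complex.one_im, Complex.zero_im] at h4
        linarith [ρ.2.2, σ.2.2]
    · rintro ⟨a, ha⟩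
      obtain ⟨t, rfl⟩ := exists_mul_one_sub_eq a
      rw [← hxi] at ha
      have him := im_ne_zero_of_normalizedXi_eq_zero ha
      rcases lt_or_gt_of_ne him with hneg | hpos
      · refine ⟨⟨1 - t, ?_, by simpa using hneg⟩, Subtype.ext ?_⟩
        · rw [← normalizedXi_eq_zero_iff (by simpa using him), normalizedXi_one_sub, ha]
        · change (1 - t) * (1 - (1 - t)) = t * (1 - t)
          ring
      · exact ⟨⟨t, (normalizedXi_eq_zero_iff him).1 ha, hpos⟩, rfl⟩
  have horder : ∀ ρ : upperZetaZeros,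
      analyticOrderNatAt riemannZeta (ρ : ℂ) = analyticOrderNatAt h (f ρ : ℂ) := by
    intro ρ
    have him : (ρ : ℂ).im ≠ 0 := ρ.2.2.ne'
    have hder : HasDerivAt (fun s : ℂ => s * (1 - s)) (1 - 2 * (ρ : ℂ)) ρ := by
      have h1 := (hasDerivAt_id (ρ : ℂ)).mul ((hasDerivAt_id (ρ : ℂ)).const_sub 1)
      refine h1.congr_deriv ?_
      simp only [id]
      ring
    -- The only critical point of s(1-s) is 1/2, which is real, so composition preserves the order
    -- of the zero.
    have hne : deriv (fun s : ℂ => s * (1 - s)) ρ ≠ 0 := by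
      rw [hder.deriv]
      intro h1
      have := congrArg Complex.im h1
      simp at this
      exact him this
    have hcomp : normalizedXi = h ∘ fun s => s * (1 - s) := funext hxi
    rw [analyticOrderNatAt, analyticOrderNatAt, analyticOrderAt_riemannZeta_eq him, hcomp,
      analyticOrderAt_comp_of_deriv_ne_zero (by fun_prop) hne]
  let e : UpperZetaZeroIndex ≃ ZeroIndex h :=
    Equiv.sigmaCongr (Equiv.ofBijective f hf) fun ρ => finCongr (horder ρ)
  rw [← e.hasProd_iff] at hprod
  convert hprod using 2 with i
  exact zetaZeroFactor_eq i.1.2.2.ne'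

theorem mainTheorem2 (s : ℂ) (hs : ∀ n : ℤ, n ≤ 1 → s ≠ (n : ℂ)) :
    Multipliable (fun i : UpperZetaZeroIndex => zetaZeroFactor s (i.1 : ℂ)) ∧
      riemannZeta s =
        (Real.pi : ℂ) ^ (s / 2) / (2 * (s - 1) * Complex.Gamma (1 + s / 2)) *
          ∏' i : UpperZetaZeroIndex, zetaZeroFactor s (i.1 : ℂ) := by
  have hprod := hasProd_zetaZeroFactor s
  refine ⟨hprod.multipliable, ?_⟩
  have h0 : s ≠ 0 := by simpa using hs 0 (by norm_num)
  have h1 : s ≠ 1 := by simpa using hs 1 le_rfl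
  have h1' : s - 1 ≠ 0 := sub_ne_zero.2 h1
  have hπ : (Real.pi : ℂ) ^ (s / 2) ≠ 0 := by
    simp [Complex.cpow_eq_zero_iff, Real.pi_ne_zero]
  -- Γ(1 + s/2) = (s/2) Γ(s/2) absorbs the factor s of s(s-1) and leaves the 2.
  rw [hprod.tprod_eq, riemannZeta_eq_mul_normalizedXi h0 h1, Complex.Gammaℝ_def, add_comm 1,
    Complex.Gamma_add_one _ (div_ne_zero h0 two_ne_zero), neg_div, Complex.cpow_neg]
  congr 1
  rw [mul_inv, mul_inv, inv_inv]
  field_simp
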